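/- Let $p\ge 1$ be an integer, let $Z$ be a standard normal random variable, and let $\Phi h=\mathbb{E}h(Z)$. Write $\|g\|=\sup_{x\in\mathbb{R}}|g(x)|$, and let $C_b^{m}(\mathbb{R})$ be the set of bounded, $m$ times differentiable functions $h:\mathbb{R}\to\mathbb{R}$ whose derivatives $h^{(k)}$, $k\le m$, are all bounded. For $h\in C_b^{p+1}(\mathbb{R})$ put \[N_p=\min\bigg\{3\|h^{(p-1)}\|,\ \frac{\Gamma(\frac{p+1}{2})\,\|h^{(p)}\|}{\sqrt{2}\,\Gamma(\frac p2+1)},\ \frac{\|h^{(p+1)}\|}{p+1}\bigg\}.\] Let $n\ge 1$ and let $X_1,\ldots,X_n$ be independent real random variables with $\mathbb{E}|X_i|^{p+1}<\infty$ and $\mathbb{E}X_i^k=\mathbb{E}Z^k$ for all $1\le i\le n$ and $1\le k\le p$, and let $W_n=\frac{1}{\sqrt n}\sum_{i=1}^nX_i$. Then, for all $h\in C_b^{p+1}(\mathbb{R})$, \[|\mathbb{E}h(W_n)-\Phi h|\le \frac{N_p}{n^{(p+1)/2}}\sum_{i=1}^n\bigg(\frac{\mathbb{E}|X_i|^{p-1}}{(p-1)!}+\frac{\mathbb{E}|X_i|^{p+1}}{p!}\bigg).\]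 If in addition $X_1,\ldots,X_n$ are identically distributed with common law $\mu$, then the right-hand side is of order $n^{-(p-1)/2}$: there are constants $c$ and $C$, depending only on $p$, $h$ and $\mu$, such that for all $n\ge1$ the right-hand side lies between $c\,n^{-(p-1)/2}$ and $C\,n^{-(p-1)/2}$, and consequently $|\mathbb{E}h(W_n)-\Phi h|\le C\,n^{-(p-1)/2}$; moreover $c>0$ whenever $h$ is not constant. -/

import Mathlib

open MeasureTheory ProbabilityTheory
open scoped Nat

universe u

noncomputable section

namespace MatchingMoments

/-- The supremum norm `sup_x |f x|` (used only for bounded functions). -/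
def supNorm (f : ℝ → ℝ) : ℝ := ⨆ x : ℝ, |f x|

/-- The class `C_b^n(ℝ)`: functions that are `n` times differentiable and bounded, with bounded
derivatives of every order up to `n`. Continuity of the `n`-th derivative is not required. -/
def MemCb (n : ℕ) (h : ℝ → ℝ) : Prop :=
  (∀ k < n, Differentiable ℝ (iteratedDeriv k h)) ∧
    ∀ k ≤ n, ∃ C : ℝ, ∀ x : ℝ, |iteratedDeriv k h x| ≤ C

/-- The constant `N_k` attached to a test function `h`, for `k ≥ 1`. -/
def N (h : ℝ → ℝ) (k : ℕ) : ℝ :=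
  min (3 * supNorm (iteratedDeriv (k - 1) h))
    (min
      (Real.Gamma (((k : ℝ) + 1) / 2) * supNorm (iteratedDeriv k h) /
        (Real.sqrt 2 * Real.Gamma ((k : ℝ) / 2 + 1)))
      (supNorm (iteratedDeriv (k + 1) h) / ((k : ℝ) + 1)))

/-- `Φ h = E h(Z)` for a standard normal `Z`. -/
def normalExp (h : ℝ → ℝ) : ℝ := ∫ x, h x ∂(gaussianReal 0 1)

/-- A law on `ℝ` with finite `(p+1)`-th absolute moment, whose moments of orders `1, …, p` are
those of the standard normal distribution. -/
def MatchesNormal (p : ℕ) (μ : Measure ℝ) : Prop :=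
  Integrable (fun x : ℝ => |x| ^ (p + 1)) μ ∧
    ∀ k : ℕ, 1 ≤ k → k ≤ p → ∫ x, x ^ k ∂μ = ∫ x, x ^ k ∂(gaussianReal 0 1)

variable {Ω : Type*}

/-- The standardised sum `W_n = n^{-1/2} ∑ X_i`. -/
def W {n : ℕ} (X : Fin n → Ω → ℝ) (ω : Ω) : ℝ := (∑ i, X i ω) / Real.sqrt n

/-- The approximation error `|E h(W_n) - Φ h|`. -/
def error [MeasurableSpace Ω] (P : Measure Ω) (h : ℝ → ℝ) {n : ℕ} (X : Fin n → Ω → ℝ) : ℝ :=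
  |(∫ ω, h (W X ω) ∂P) - normalExp h|

/-- The right-hand side
`N_p n^{-(p+1)/2} ∑_i (E|X_i|^{p-1} / (p-1)! + E|X_i|^{p+1} / p!)`, for `p ≥ 1`. -/
def bound [MeasurableSpace Ω] (P : Measure Ω) (h : ℝ → ℝ) (p : ℕ) {n : ℕ}
    (X : Fin n → Ω → ℝ) : ℝ :=
  N h p / (n : ℝ) ^ (((p : ℝ) + 1) / 2) *
    ∑ i, ((∫ ω, |X i ω| ^ (p - 1) ∂P) / ((p - 1)! : ℝ) +
      (∫ ω, |X i ω| ^ (p + 1) ∂P) / (p ! : ℝ))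

end MatchingMoments

end

/-!
Stein's method. The equation `f' - x f = h - Φ h` has the bounded solution
`f(x) = -∫₀^{π/2} sin θ E h'(x cos θ + Z sin θ) dθ`, so that
`f^{(j)}(x) = -∫₀^{π/2} cos^j θ sin θ E h^{(j+1)}(x cos θ + Z sin θ) dθ`. Three estimates of
`f^{(p)}` result: by `‖h^{(p+1)}‖` directly, by `‖h^{(p)}‖` after a Gaussian integration by parts,
and by `2 ‖h^{(p-1)}‖` from a comparison principle for the Stein equation differentiated `p - 1`
times. Hence `‖f^{(p)}‖ ≤ N_p`.

Write `W = ∑ Y_i` with `Y_i` of variance `v_i` and `∑ v_i = 1`. Then `E h(W) - Φ h` is the sum of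
`v_i E f'(W) - E[Y_i f(W)]`. Expanding both expectations around `W - Y_i`, which is independent of
`Y_i`, the Taylor polynomials cancel: the normal moments satisfy `m_{k+2} = (k + 1) v_i m_k`, and
`Y_i` has the same moments up to order `p`. The Taylor remainders give the bound.
-/

namespace MatchingMoments

/-! ### The normal distribution -/

section Gaussian

variable {m : ℝ} {v : NNReal}

lemma integrable_gaussianReal_iff (hv : v ≠ 0) {g : ℝ → ℝ} :
    Integrable g (gaussianReal m v) ↔ Integrable fun x => g x * gaussianPDFReal m v x := by
  rw [gaussianReal_of_var_ne_zero m hv, integrable_withDensity_iff (measurable_gaussianPDF m v)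
    (.of_forall fun _ => gaussianPDF_lt_top)]
  simp only [toReal_gaussianPDF]

lemma hasDerivAt_gaussianPDFReal (hv : v ≠ 0) (x : ℝ) :
    HasDerivAt (gaussianPDFReal m v) (-((x - m) / v) * gaussianPDFReal m v x) x := by
  have hv' : (v : ℝ) ≠ 0 := mod_cast hv
  have hexponent : HasDerivAt (fun y : ℝ => -(y - m) ^ 2 / (2 * v)) (-((x - m) / v)) x := by
    convert! (((hasDerivAt_id x).sub_const m).pow 2).neg.div_const (2 * (v : ℝ)) using 1
    simp only [id_eq, Nat.cast_ofNat]
    field_simp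
    ring
  rw [gaussianPDFReal_def]
  convert! hexponent.exp.const_mul (Real.sqrt (2 * Real.pi * v))⁻¹ using 1
  ring

lemma integral_sub_mul_gaussianReal {g g' : ℝ → ℝ} (hg : ∀ x, HasDerivAt g (g' x) x)
    (hgi : Integrable g (gaussianReal m v)) (hgi' : Integrable g' (gaussianReal m v))
    (hxgi : Integrable (fun x => (x - m) * g x) (gaussianReal m v)) :
    ∫ x, (x - m) * g x ∂gaussianReal m v = v * ∫ x, g' x ∂gaussianReal m v := by
  rcases eq_or_ne v 0 with rfl | hv
  · simp [gaussianReal_zero_var]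
  have hv' : (v : ℝ) ≠ 0 := mod_cast hv
  rw [integrable_gaussianReal_iff hv] at hgi hgi' hxgi
  have by_parts := integral_mul_deriv_eq_deriv_mul_of_integrable
    (fun x _ => hg x) (fun x _ => hasDerivAt_gaussianPDFReal (m := m) hv x)
    ((hxgi.const_mul (-(v : ℝ)⁻¹)).congr (.of_forall fun x => by simp only [Pi.mul_apply]; ring))
    hgi' hgi
  simp only [integral_gaussianReal_eq_integral_smul hv, smul_eq_mul]
  calc ∫ x, gaussianPDFReal m v x * ((x - m) * g x)
      = -v * ∫ x, g x * (-((x - m) / v) * gaussianPDFReal m v x) := by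
        rw [← integral_const_mul]
        congr with x
        field_simp
    _ = v * ∫ x, gaussianPDFReal m v x * g' x := by
        rw [by_parts, neg_mul_neg]
        simp only [mul_comm]

lemma integrable_pow_gaussianReal (k : ℕ) : Integrable (fun x => x ^ k) (gaussianReal m v) :=
  (memLp_id_gaussianReal k).integrable_norm_pow'.mono' (by fun_prop) (.of_forall fun x => by simp)

lemma integrable_abs_gaussianReal : Integrable (fun x => |x|) (gaussianReal m v) := by
  simpa using (integrable_pow_gaussianReal 1).abs

lemma integral_pow_add_two_gaussianReal (v : NNReal) (k : ℕ) :
    ∫ x, x ^ (k + 2) ∂gaussianReal 0 v = v * ((k + 1) * ∫ x, x ^ k ∂gaussianReal 0 v) := by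
  rw [← integral_const_mul]
  convert! integral_sub_mul_gaussianReal (m := 0) (g := fun x => x ^ (k + 1))
    (fun x => by simpa using hasDerivAt_pow (k + 1) x) (integrable_pow_gaussianReal _)
    ((integrable_pow_gaussianReal k).const_mul _)
    ((integrable_pow_gaussianReal (k + 2)).congr (.of_forall fun x => by ring)) using 3
  ring

lemma integral_abs_gaussianReal (v : NNReal) :
    ∫ x, |x| ∂gaussianReal 0 v = Real.sqrt (2 * v / Real.pi) := by
  rcases eq_or_ne v 0 with rfl | hv
  · simp [gaussianReal_zero_var]
  have half_line : ∫ x in Set.Ioi (0 : ℝ), x * Real.exp (-(1 / (2 * v)) * x ^ 2) = v := by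
    have := integral_rpow_mul_exp_neg_mul_rpow (p := 2) (q := 1) (b := 1 / (2 * (v : ℝ)))
      two_pos (by norm_num) (by positivity)
    have cancel : (2 : ℝ) * v * 2⁻¹ = v := by ring
    norm_num at this
    simpa [Real.rpow_neg_one, cancel] using this
  calc ∫ x, |x| ∂gaussianReal 0 v
      = (Real.sqrt (2 * Real.pi * v))⁻¹ * ∫ x, |x| * Real.exp (-(1 / (2 * v)) * |x| ^ 2) := by
        rw [integral_gaussianReal_eq_integral_smul hv, ← integral_const_mul]
        congr with x
        simp only [gaussianPDFReal, smul_eq_mul, sub_zero, sq_abs]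
        ring_nf
    _ = (Real.sqrt (2 * Real.pi * v))⁻¹ * (2 * v) := by
        rw [integral_comp_abs (f := fun x => x * Real.exp (-(1 / (2 * v)) * x ^ 2)), half_line]
    _ = Real.sqrt (2 * v / Real.pi) := by
        rw [eq_comm, Real.sqrt_eq_iff_mul_self_eq (by positivity) (by positivity)]
        field_simp
        rw [Real.sq_sqrt (by positivity)]

end Gaussian

/-! ### Integrals of trigonometric functions -/

lemma integral_cos_pow_mul_sin (j : ℕ) :
    ∫ θ in (0 : ℝ)..(Real.pi / 2), Real.cos θ ^ j * Real.sin θ = 1 / ((j : ℝ) + 1) := by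
  have hderiv (θ : ℝ) : HasDerivAt (fun θ => -(Real.cos θ ^ (j + 1) / ((j : ℝ) + 1)))
      (Real.cos θ ^ j * Real.sin θ) θ := by
    convert! (((Real.hasDerivAt_cos θ).pow (j + 1)).div_const ((j : ℝ) + 1)).neg using 1
    push_cast
    field_simp
  rw [intervalIntegral.integral_eq_sub_of_hasDerivAt (fun θ _ => hderiv θ)
    (Continuous.intervalIntegrable (by fun_prop) _ _)]
  simp

lemma integral_cos_pow_eq_gamma (j : ℕ) :
    ∫ θ in (0 : ℝ)..(Real.pi / 2), Real.cos θ ^ j =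
      Real.sqrt Real.pi / 2 * Real.Gamma (((j : ℝ) + 1) / 2) / Real.Gamma ((j : ℝ) / 2 + 1) := by
  induction j using Nat.twoStepInduction with
  | zero =>
    simp only [pow_zero, integral_one, Nat.cast_zero, zero_add, zero_div, Real.Gamma_one,
      Real.Gamma_one_half_eq, sub_zero, div_one]
    rw [div_mul_eq_mul_div, Real.mul_self_sqrt Real.pi_pos.le]
  | one =>
    have hGamma : Real.Gamma ((1 : ℝ) / 2 + 1) = 1 / 2 * Real.sqrt Real.pi := by
      rw [Real.Gamma_add_one (by norm_num), Real.Gamma_one_half_eq]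
    simp only [pow_one, integral_cos, Nat.cast_one, hGamma, Real.sin_pi_div_two, Real.sin_zero]
    norm_num
    field_simp
  | more j ih _ =>
    have hnum : ((j + 2 : ℕ) + 1 : ℝ) / 2 = ((j : ℝ) + 1) / 2 + 1 := by push_cast; ring
    have hden : ((j + 2 : ℕ) : ℝ) / 2 + 1 = ((j : ℝ) / 2 + 1) + 1 := by push_cast; ring
    have hGamma : Real.Gamma ((j : ℝ) / 2 + 1) ≠ 0 := (Real.Gamma_pos_of_pos (by positivity)).ne'
    have hhalf : (j : ℝ) / 2 + 1 ≠ 0 := by positivity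
    rw [integral_cos_pow, ih, hnum, hden,
      Real.Gamma_add_one (s := ((j : ℝ) + 1) / 2) (by positivity), Real.Gamma_add_one hhalf,
      Real.cos_pi_div_two, Real.sin_zero]
    field_simp [hGamma]
    ring

/-! ### Functions with bounded derivatives -/

section BoundedDerivatives

variable {n k : ℕ} {f g h : ℝ → ℝ}

lemma supNorm_nonneg (f : ℝ → ℝ) : 0 ≤ supNorm f :=
  Real.iSup_nonneg fun _ => abs_nonneg _

lemma supNorm_le {M : ℝ} (hf : ∀ x, |f x| ≤ M) : supNorm f ≤ M :=
  ciSup_le hf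

lemma MemCb.abs_iteratedDeriv_le (hh : MemCb n h) (hk : k ≤ n) (x : ℝ) :
    |iteratedDeriv k h x| ≤ supNorm (iteratedDeriv k h) := by
  obtain ⟨C, hC⟩ := hh.2 k hk
  exact le_ciSup (f := fun y => |iteratedDeriv k h y|) ⟨C, Set.forall_mem_range.2 hC⟩ x

lemma MemCb.abs_le (hh : MemCb n h) (x : ℝ) : |h x| ≤ supNorm h := by
  simpa using hh.abs_iteratedDeriv_le (Nat.zero_le n) x

lemma MemCb.hasDerivAt_iteratedDeriv (hh : MemCb n h) (hk : k < n) (x : ℝ) :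
    HasDerivAt (iteratedDeriv k h) (iteratedDeriv (k + 1) h x) x := by
  rw [iteratedDeriv_succ]
  exact (hh.1 k hk x).hasDerivAt

lemma MemCb.mono (hh : MemCb n h) (hk : k ≤ n) : MemCb k h :=
  ⟨fun j hj => hh.1 j (hj.trans_le hk), fun j hj => hh.2 j (hj.trans hk)⟩

protected lemma MemCb.iteratedDeriv (hh : MemCb (n + k) h) : MemCb n (iteratedDeriv k h) := by
  have iterate (j : ℕ) : iteratedDeriv j (iteratedDeriv k h) = iteratedDeriv (j + k) h := by
    simp only [iteratedDeriv_eq_iterate, Function.iterate_add_apply]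
  exact ⟨fun j hj => iterate j ▸ hh.1 (j + k) (by lia),
    fun j hj => iterate j ▸ hh.2 (j + k) (by lia)⟩

protected lemma MemCb.deriv (hh : MemCb (n + 1) h) : MemCb n (deriv h) :=
  iteratedDeriv_one (f := h) ▸ hh.iteratedDeriv

lemma MemCb.hasDerivAt (hh : MemCb (n + 1) h) (x : ℝ) : HasDerivAt h (deriv h x) x := by
  simpa [iteratedDeriv_one] using hh.hasDerivAt_iteratedDeriv n.succ_pos x

lemma MemCb.continuous (hh : MemCb (n + 1) h) : Continuous h :=
  continuous_iff_continuousAt.2 fun x => (hh.hasDerivAt x).continuousAt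

lemma measurable_iteratedDeriv (hh : Measurable h) (k : ℕ) : Measurable (iteratedDeriv k h) := by
  cases k with
  | zero => simpa using hh
  | succ k => exact iteratedDeriv_succ (f := h) ▸ measurable_deriv _

lemma integrable_of_abs_le {Ω : Type*} [MeasurableSpace Ω] {P : Measure Ω} [IsFiniteMeasure P]
    {U : Ω → ℝ} {M : ℝ} (hU : AEMeasurable U P) (hM : ∀ ω, |U ω| ≤ M) : Integrable U P :=
  (integrable_const M).mono' hU.aestronglyMeasurable (.of_forall hM)

lemma MemCb.contDiff (hh : MemCb (n + 1) h) : ContDiff ℝ n h :=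
  contDiff_of_differentiable_iteratedDeriv fun k hk =>
    hh.1 k (Nat.lt_succ_of_le (mod_cast hk))

lemma MemCb.iteratedDerivWithin_eq (hh : MemCb n h) (hk : k ≤ n) {s : Set ℝ}
    (hs : UniqueDiffOn ℝ s) {x : ℝ} (hx : x ∈ s) :
    iteratedDerivWithin k h s x = iteratedDeriv k h x := by
  induction k generalizing x with
  | zero => simp
  | succ k ih =>
    rw [iteratedDerivWithin_succ, derivWithin_congr (fun y hy => ih (by lia) hy) (ih (by lia) hx),
      (hh.1 k hk x).derivWithin (hs x hx), iteratedDeriv_succ]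

lemma MemCb.abs_taylor_remainder_le (hh : MemCb n h) (a b : ℝ) :
    |h (a + b) - ∑ j ∈ Finset.range n, iteratedDeriv j h a * b ^ j / (j ! : ℝ)| ≤
      supNorm (iteratedDeriv n h) * |b| ^ n / (n ! : ℝ) := by
  rcases n with _ | n
  · simpa using hh.abs_le (a + b)
  rcases eq_or_ne b 0 with rfl | hb
  · simp [Finset.sum_range_succ']
  have hab : a ≠ a + b := by simpa using hb
  have within {k : ℕ} (hk : k ≤ n + 1) {x : ℝ} (hx : x ∈ Set.uIcc a (a + b)) :
      iteratedDerivWithin k h (Set.uIcc a (a + b)) x = iteratedDeriv k h x :=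
    hh.iteratedDerivWithin_eq hk (uniqueDiffOn_uIcc hab) hx
  obtain ⟨ξ, hξ, remainder_eq⟩ := taylor_mean_remainder_lagrange hab hh.contDiff.contDiffOn
    ((hh.1 n n.lt_succ_self).differentiableOn.congr fun x hx =>
      within n.le_succ (Set.uIoo_subset_uIcc_self hx))
  have taylor_eq : taylorWithinEval h n (Set.uIcc a (a + b)) a (a + b) =
      ∑ j ∈ Finset.range (n + 1), iteratedDeriv j h a * b ^ j / (j ! : ℝ) := by
    rw [taylor_within_apply]
    refine Finset.sum_congr rfl fun j hj => ?_
    rw [within (Finset.mem_range.1 hj).le Set.left_mem_uIcc, add_sub_cancel_left, smul_eq_mul]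
    ring
  rw [← taylor_eq, remainder_eq, within le_rfl (Set.uIoo_subset_uIcc_self hξ),
    add_sub_cancel_left, abs_div, abs_mul, abs_pow, Nat.abs_cast]
  gcongr
  exact hh.abs_iteratedDeriv_le le_rfl ξ

lemma eq_zero_of_hasDerivAt_const {C c : ℝ} (hf : ∀ x, |f x| ≤ C)
    (hfc : ∀ x, HasDerivAt f c x) : c = 0 := by
  have affine (x : ℝ) : f x = f 0 + c * x := by
    have hd (y : ℝ) : HasDerivAt (fun y => f y - c * y) 0 y := by
      simpa using (hfc y).fun_sub ((hasDerivAt_id y).const_mul c)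
    have := is_const_of_deriv_eq_zero (fun y => (hd y).differentiableAt) (fun y => (hd y).deriv) x 0
    linarith
  by_contra hc
  have h_far := hf ((2 * C + 1) / c)
  rw [affine, mul_div_cancel₀ _ hc] at h_far
  linarith [(abs_le.1 h_far).2, (abs_le.1 (hf 0)).1]

lemma MemCb.exists_eq_const_of_iteratedDeriv_eq_zero (hh : MemCb n h) (hk : k ≤ n)
    (hzero : ∀ x, iteratedDeriv k h x = 0) : ∃ a, ∀ x, h x = a := by
  induction k with
  | zero => exact ⟨0, by simpa using hzero⟩
  | succ k ih =>
    have constant (x : ℝ) : iteratedDeriv k h x = iteratedDeriv k h 0 :=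
      is_const_of_deriv_eq_zero (hh.1 k hk) (fun y => by rw [← iteratedDeriv_succ, hzero]) x 0
    cases k with
    | zero => exact ⟨h 0, by simpa using constant⟩
    | succ k =>
      refine ih (by lia) fun x => (constant x).trans ?_
      exact eq_zero_of_hasDerivAt_const (hh.abs_iteratedDeriv_le (k := k) (by lia))
        fun x => constant x ▸ hh.hasDerivAt_iteratedDeriv (by lia) x

lemma MemCb.supNorm_iteratedDeriv_pos (hh : MemCb n h) (hk : k ≤ n)
    (hconst : ¬∃ a, ∀ x, h x = a) : 0 < supNorm (iteratedDeriv k h) := by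
  refine (supNorm_nonneg _).lt_of_ne' fun hzero => hconst ?_
  refine hh.exists_eq_const_of_iteratedDeriv_eq_zero hk fun x => abs_nonpos_iff.1 ?_
  exact hzero ▸ hh.abs_iteratedDeriv_le hk x

end BoundedDerivatives

/-! ### The Ornstein–Uhlenbeck resolvent -/

/-- Lebesgue measure on `(0, π / 2]` times the standard normal law: the law of the pairs `(θ, z)`
over which the Ornstein–Uhlenbeck resolvent averages. -/
noncomputable def arcMeasure : Measure (ℝ × ℝ) :=
  (volume.restrict (Set.Ioc 0 (Real.pi / 2))).prod (gaussianReal 0 1)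

instance : IsFiniteMeasure arcMeasure := by
  unfold arcMeasure
  infer_instance

/-- The point `x cos θ + z sin θ` reached from `x` by rotating through the angle `θ` towards `z`,
for `q = (θ, z)`. -/
noncomputable def rot (x : ℝ) (q : ℝ × ℝ) : ℝ := x * Real.cos q.1 + q.2 * Real.sin q.1

/-- The resolvent `∫₀^∞ e^{-(j+1)t} E g(e^{-t} x + √(1 - e^{-2t}) Z) dt` of the
Ornstein–Uhlenbeck semigroup, written in the variable `θ` with `cos θ = e^{-t}`. -/
noncomputable def ouResolvent (j : ℕ) (g : ℝ → ℝ) (x : ℝ) : ℝ :=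
  ∫ q, Real.cos q.1 ^ j * Real.sin q.1 * g (rot x q) ∂arcMeasure

section Resolvent

variable {g : ℝ → ℝ} {M : ℝ}

@[fun_prop]
lemma continuous_rot (x : ℝ) : Continuous (rot x) := by
  unfold rot
  fun_prop

lemma hasDerivAt_rot_start (x : ℝ) (q : ℝ × ℝ) :
    HasDerivAt (fun y => rot y q) (Real.cos q.1) x := by
  simpa [rot] using ((hasDerivAt_id x).mul_const (Real.cos q.1)).add_const (q.2 * Real.sin q.1)

lemma hasDerivAt_rot_target (x θ z : ℝ) :
    HasDerivAt (fun z => rot x (θ, z)) (Real.sin θ) z := by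
  simpa [rot] using ((hasDerivAt_id z).mul_const (Real.sin θ)).const_add (x * Real.cos θ)

lemma hasDerivAt_rot_angle (x θ z : ℝ) :
    HasDerivAt (fun θ => rot x (θ, z)) (z * Real.cos θ - x * Real.sin θ) θ := by
  convert! ((Real.hasDerivAt_cos θ).const_mul x).fun_add ((Real.hasDerivAt_sin θ).const_mul z)
    using 1
  ring

lemma abs_cos_pow_le_one (j : ℕ) (θ : ℝ) : |Real.cos θ ^ j| ≤ 1 := by
  rw [abs_pow]
  exact pow_le_one₀ (abs_nonneg _) (Real.abs_cos_le_one θ)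

lemma abs_cos_pow_mul_sin_le_one (j : ℕ) (θ : ℝ) : |Real.cos θ ^ j * Real.sin θ| ≤ 1 := by
  rw [abs_mul]
  exact mul_le_one₀ (abs_cos_pow_le_one j θ) (abs_nonneg _) (Real.abs_sin_le_one θ)

lemma integrable_cos_pow_mul_sin (j : ℕ) :
    Integrable (fun q : ℝ × ℝ => Real.cos q.1 ^ j * Real.sin q.1) arcMeasure :=
  integrable_of_abs_le (by fun_prop) fun q => abs_cos_pow_mul_sin_le_one j q.1

lemma integrable_cos_pow_mul_snd (j : ℕ) :
    Integrable (fun q : ℝ × ℝ => Real.cos q.1 ^ j * q.2) arcMeasure :=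
  (integrable_abs_gaussianReal.comp_snd _).mono' (by fun_prop) (.of_forall fun q => by
    rw [Real.norm_eq_abs, abs_mul]
    exact mul_le_of_le_one_left (abs_nonneg _) (abs_cos_pow_le_one j q.1))

lemma cos_nonneg_of_mem_Ioc {θ : ℝ} (hθ : θ ∈ Set.Ioc 0 (Real.pi / 2)) : 0 ≤ Real.cos θ :=
  Real.cos_nonneg_of_mem_Icc ⟨by linarith [hθ.1, Real.pi_pos], hθ.2⟩

lemma integral_abs_cos_pow_mul_sin (j : ℕ) :
    ∫ q, |Real.cos q.1 ^ j * Real.sin q.1| ∂arcMeasure = 1 / ((j : ℝ) + 1) := by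
  rw [arcMeasure, integral_fun_fst (fun θ => |Real.cos θ ^ j * Real.sin θ|), probReal_univ,
    one_smul, ← integral_cos_pow_mul_sin, intervalIntegral.integral_of_le (by positivity)]
  refine setIntegral_congr_fun measurableSet_Ioc fun θ hθ => abs_of_nonneg ?_
  exact mul_nonneg (pow_nonneg (cos_nonneg_of_mem_Ioc hθ) j)
    (Real.sin_nonneg_of_nonneg_of_le_pi hθ.1.le (by linarith [hθ.2, Real.pi_pos]))

lemma integral_abs_cos_pow_mul_snd (j : ℕ) :
    ∫ q, |Real.cos q.1 ^ j * q.2| ∂arcMeasure =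
      Real.Gamma (((j : ℝ) + 1) / 2) / (Real.sqrt 2 * Real.Gamma ((j : ℝ) / 2 + 1)) := by
  have hcos : ∫ θ in Set.Ioc 0 (Real.pi / 2), |Real.cos θ ^ j| =
      Real.sqrt Real.pi / 2 * Real.Gamma (((j : ℝ) + 1) / 2) / Real.Gamma ((j : ℝ) / 2 + 1) := by
    rw [← integral_cos_pow_eq_gamma, intervalIntegral.integral_of_le (by positivity)]
    exact setIntegral_congr_fun measurableSet_Ioc fun θ hθ =>
      abs_of_nonneg (pow_nonneg (cos_nonneg_of_mem_Ioc hθ) j)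
  simp only [abs_mul]
  rw [arcMeasure, integral_prod_mul (fun θ => |Real.cos θ ^ j|) (fun z => |z|), hcos,
    integral_abs_gaussianReal, NNReal.coe_one, mul_one, Real.sqrt_div two_pos.le]
  field_simp
  rw [Real.sq_sqrt two_pos.le]

lemma integrable_mul_comp_rot {w : ℝ × ℝ → ℝ} (hw : Integrable w arcMeasure)
    (hg : Measurable g) (hM : ∀ x, |g x| ≤ M) (x : ℝ) :
    Integrable (fun q => w q * g (rot x q)) arcMeasure :=
  hw.mul_bdd (hg.comp (continuous_rot x).measurable).aestronglyMeasurable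
    (.of_forall fun q => hM (rot x q))

lemma abs_integral_mul_comp_rot_le {w : ℝ × ℝ → ℝ} (hw : Integrable w arcMeasure)
    (hM : ∀ x, |g x| ≤ M) (x : ℝ) :
    |∫ q, w q * g (rot x q) ∂arcMeasure| ≤ (∫ q, |w q| ∂arcMeasure) * M := by
  rw [← integral_mul_const, ← Real.norm_eq_abs]
  refine norm_integral_le_of_norm_le (hw.abs.mul_const M) (.of_forall fun q => ?_)
  rw [Real.norm_eq_abs, abs_mul]
  exact mul_le_mul_of_nonneg_left (hM _) (abs_nonneg _)

lemma abs_ouResolvent_le (hM : ∀ x, |g x| ≤ M) (j : ℕ) (x : ℝ) :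
    |ouResolvent j g x| ≤ M / ((j : ℝ) + 1) := by
  refine (abs_integral_mul_comp_rot_le (integrable_cos_pow_mul_sin j) hM x).trans_eq ?_
  rw [integral_abs_cos_pow_mul_sin, one_div_mul_eq_div]

lemma hasDerivAt_ouResolvent (hg : MemCb 1 g) (j : ℕ) (x : ℝ) :
    HasDerivAt (ouResolvent j g) (ouResolvent (j + 1) (deriv g) x) x := by
  have integrable (y : ℝ) := integrable_mul_comp_rot (integrable_cos_pow_mul_sin j)
    hg.continuous.measurable hg.abs_le y
  have integrable' := integrable_mul_comp_rot (integrable_cos_pow_mul_sin (j + 1))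
    (measurable_deriv g) hg.deriv.abs_le x
  refine (hasDerivAt_integral_of_dominated_loc_of_deriv_le (μ := arcMeasure)
    (F' := fun y q => Real.cos q.1 ^ (j + 1) * Real.sin q.1 * deriv g (rot y q))
    (bound := fun _ => supNorm (deriv g)) Filter.univ_mem
    (.of_forall fun y => (integrable y).aestronglyMeasurable) (integrable x)
    integrable'.aestronglyMeasurable (.of_forall fun q y _ => ?_) (integrable_const _)
    (.of_forall fun q y _ => ?_)).2
  · rw [Real.norm_eq_abs, abs_mul]
    exact (mul_le_of_le_one_left (abs_nonneg _)
      (abs_cos_pow_mul_sin_le_one (j + 1) q.1)).trans (hg.deriv.abs_le _)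
  · convert! ((hg.hasDerivAt (rot y q)).comp y (hasDerivAt_rot_start y q)).const_mul
      (Real.cos q.1 ^ j * Real.sin q.1) using 1
    ring

lemma integral_mul_comp_rot_gaussianReal (hg : MemCb 1 g) (x θ : ℝ) :
    ∫ z, z * g (rot x (θ, z)) ∂gaussianReal 0 1 =
      Real.sin θ * ∫ z, deriv g (rot x (θ, z)) ∂gaussianReal 0 1 := by
  have hrot : Measurable fun z : ℝ => rot x (θ, z) := by fun_prop
  have integrable : Integrable (fun z => g (rot x (θ, z))) (gaussianReal 0 1) :=
    integrable_of_abs_le (hg.continuous.measurable.comp hrot).aemeasurable fun z => hg.abs_le _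
  have integrable' : Integrable (fun z => deriv g (rot x (θ, z))) (gaussianReal 0 1) :=
    integrable_of_abs_le ((measurable_deriv g).comp hrot).aemeasurable fun z => hg.deriv.abs_le _
  have by_parts := integral_sub_mul_gaussianReal (m := 0) (v := 1)
    (fun z => by
      simpa [Function.comp_def, mul_comm] using
        (hg.hasDerivAt _).comp z (hasDerivAt_rot_target x θ z))
    integrable (integrable'.const_mul (Real.sin θ))
    (((integrable_pow_gaussianReal 1).mul_bdd integrable.aestronglyMeasurable
      (.of_forall fun z => hg.abs_le _)).congr (.of_forall fun z => by simp))
  simpa [integral_const_mul] using by_parts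

lemma ouResolvent_deriv (hg : MemCb 1 g) (j : ℕ) (x : ℝ) :
    ouResolvent j (deriv g) x = ∫ q, Real.cos q.1 ^ j * q.2 * g (rot x q) ∂arcMeasure := by
  have integrable := integrable_mul_comp_rot (integrable_cos_pow_mul_snd j)
    hg.continuous.measurable hg.abs_le x
  have integrable' := integrable_mul_comp_rot (integrable_cos_pow_mul_sin j)
    (measurable_deriv g) hg.deriv.abs_le x
  rw [arcMeasure] at integrable integrable'
  rw [ouResolvent, arcMeasure, integral_prod _ integrable', integral_prod _ integrable]
  congr with θ
  simp only [mul_assoc, integral_const_mul, integral_mul_comp_rot_gaussianReal hg]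

lemma abs_ouResolvent_deriv_le (hg : MemCb 1 g) (j : ℕ) (x : ℝ) :
    |ouResolvent j (deriv g) x| ≤ Real.Gamma (((j : ℝ) + 1) / 2) * supNorm g /
      (Real.sqrt 2 * Real.Gamma ((j : ℝ) / 2 + 1)) := by
  rw [ouResolvent_deriv hg]
  refine (abs_integral_mul_comp_rot_le (integrable_cos_pow_mul_snd j) hg.abs_le x).trans_eq ?_
  rw [integral_abs_cos_pow_mul_snd, div_mul_eq_mul_div]

lemma integral_deriv_comp_rot_angle (hg : MemCb 2 g) (x z : ℝ) :
    ∫ θ in Set.Ioc 0 (Real.pi / 2),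
      (z * Real.cos θ - x * Real.sin θ) * deriv g (rot x (θ, z)) = g z - g x := by
  have hderiv (θ : ℝ) : HasDerivAt (fun θ => g (rot x (θ, z)))
      ((z * Real.cos θ - x * Real.sin θ) * deriv g (rot x (θ, z))) θ := by
    simpa [Function.comp_def, mul_comm] using (hg.hasDerivAt _).comp θ (hasDerivAt_rot_angle x θ z)
  have hcont : Continuous (deriv g) := hg.deriv.continuous
  rw [← intervalIntegral.integral_of_le (by positivity),
    intervalIntegral.integral_eq_sub_of_hasDerivAt (fun θ _ => hderiv θ)
      (Continuous.intervalIntegrable (by fun_prop) _ _)]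
  simp [rot]

lemma ouResolvent_stein_equation (hg : MemCb 2 g) (x : ℝ) :
    ouResolvent 1 (deriv (deriv g)) x - x * ouResolvent 0 (deriv g) x = normalExp g - g x := by
  have integrable_z := integrable_mul_comp_rot (integrable_cos_pow_mul_snd 1)
    hg.deriv.continuous.measurable hg.deriv.abs_le x
  have integrable_x := (integrable_mul_comp_rot (integrable_cos_pow_mul_sin 0)
    hg.deriv.continuous.measurable hg.deriv.abs_le x).const_mul x
  have split (q : ℝ × ℝ) :
      Real.cos q.1 ^ 1 * q.2 * deriv g (rot x q) -
        x * (Real.cos q.1 ^ 0 * Real.sin q.1 * deriv g (rot x q)) =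
      (q.2 * Real.cos q.1 - x * Real.sin q.1) * deriv g (rot x q) := by
    ring
  have integrable := (integrable_z.sub integrable_x).congr (.of_forall split)
  rw [ouResolvent_deriv hg.deriv, ouResolvent, ← integral_const_mul,
    ← integral_sub integrable_z integrable_x]
  simp only [split]
  rw [arcMeasure, integral_prod_symm _ integrable]
  simp only [integral_deriv_comp_rot_angle hg]
  rw [integral_sub (integrable_of_abs_le hg.continuous.aemeasurable hg.abs_le)
    (integrable_const _), integral_const, probReal_univ, one_smul, normalExp]

end Resolvent

/-! ### A comparison principle -/

section Comparison

variable {l : ℕ} {u r H : ℝ → ℝ} {U R : ℝ}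

/- The factor `e^{-t²/2}` cancels the term `t u` of `u'`, and the division by `t^{l+1}` cancels the
remaining multiple `(l + 1) u`, so the signs of `H` and `r` decide that of the derivative. -/
lemma hasDerivAt_exp_mul_div_pow {t : ℝ} (ht : t ≠ 0)
    (hu : HasDerivAt u (t * u t + r t + H t) t) (hr : HasDerivAt r (l * u t) t) :
    HasDerivAt (fun t => Real.exp (-t ^ 2 / 2) * ((t * u t + r t) / t ^ (l + 1)))
      (Real.exp (-t ^ 2 / 2) * ((t ^ 2 * H t - (l + 1) * r t) / t ^ (l + 2))) t := by
  have hexp : HasDerivAt (fun t : ℝ => Real.exp (-t ^ 2 / 2)) (Real.exp (-t ^ 2 / 2) * -t) t := by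
    convert! ((hasDerivAt_pow 2 t).neg.div_const 2).exp using 1
    simp only [mul_neg, Pi.neg_apply, Nat.cast_ofNat, Nat.add_one_sub_one, pow_one]
    ring
  convert! hexp.fun_mul ((((hasDerivAt_id t).fun_mul hu).fun_add hr).fun_div
    (hasDerivAt_pow (l + 1) t) (pow_ne_zero _ ht)) using 1
  simp only [id_eq, Nat.add_sub_cancel]
  push_cast
  field_simp
  ring

lemma tendsto_exp_mul_div_pow (l : ℕ) (hU : ∀ t, |u t| ≤ U) (hR : ∀ t, |r t| ≤ R) :
    Filter.Tendsto (fun t => Real.exp (-t ^ 2 / 2) * ((t * u t + r t) / t ^ (l + 1)))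
      Filter.atTop (nhds 0) := by
  have hexp : Filter.Tendsto (fun t : ℝ => Real.exp (-t ^ 2 / 2)) Filter.atTop (nhds 0) := by
    refine Real.tendsto_exp_atBot.comp (Filter.Tendsto.atBot_div_const two_pos ?_)
    exact Filter.tendsto_neg_atTop_atBot.comp (Filter.tendsto_pow_atTop two_ne_zero)
  refine hexp.zero_mul_isBoundedUnder_le (Filter.isBoundedUnder_of_eventually_le (a := U + R) ?_)
  filter_upwards [Filter.eventually_ge_atTop 1] with t ht
  have hR0 : 0 ≤ R := (abs_nonneg _).trans (hR t)
  have hU0 : 0 ≤ U := (abs_nonneg _).trans (hU t)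
  have ht0 : 0 < t := one_pos.trans_le ht
  rw [Function.comp_apply, Real.norm_eq_abs, abs_div, abs_of_pos (pow_pos ht0 _),
    div_le_iff₀ (pow_pos ht0 _)]
  calc |t * u t + r t| ≤ t * |u t| + |r t| := by
        simpa [abs_mul, abs_of_pos ht0] using abs_add_le (t * u t) (r t)
    _ ≤ t * U + t * R := by
        gcongr
        · exact hU t
        · exact (hR t).trans (le_mul_of_one_le_left hR0 ht)
    _ = (U + R) * t := by ring
    _ ≤ (U + R) * t ^ (l + 1) := by
        gcongr
        exact le_self_pow₀ ht l.succ_ne_zero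

lemma mul_add_nonpos_of_pos (hu : ∀ x, HasDerivAt u (x * u x + r x + H x) x)
    (hr : ∀ x, HasDerivAt r (l * u x) x) (hH : ∀ x, 0 ≤ H x) (hr0 : ∀ x, r x ≤ 0)
    (hU : ∀ x, |u x| ≤ U) (hR : ∀ x, |r x| ≤ R) {x : ℝ} (hx : 0 < x) : x * u x + r x ≤ 0 := by
  have hderiv (t : ℝ) (ht : 0 < t) := hasDerivAt_exp_mul_div_pow ht.ne' (hu t) (hr t)
  have hmono : MonotoneOn
      (fun t => Real.exp (-t ^ 2 / 2) * ((t * u t + r t) / t ^ (l + 1))) (Set.Ioi 0) := by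
    refine monotoneOn_of_hasDerivWithinAt_nonneg (convex_Ioi 0)
      (fun t ht => (hderiv t ht).continuousAt.continuousWithinAt)
      (fun t ht => (hderiv t (interior_subset ht)).hasDerivWithinAt) fun t ht => ?_
    have ht0 : 0 < t := interior_subset ht
    have hH := mul_nonneg (sq_nonneg t) (hH t)
    have hr := mul_nonpos_of_nonneg_of_nonpos (show (0 : ℝ) ≤ l + 1 by positivity) (hr0 t)
    exact mul_nonneg (Real.exp_nonneg _) (div_nonneg (by linarith) (by positivity))
  have hle : Real.exp (-x ^ 2 / 2) * ((x * u x + r x) / x ^ (l + 1)) ≤ 0 :=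
    ge_of_tendsto (tendsto_exp_mul_div_pow l hU hR)
      ((Filter.eventually_ge_atTop x).mono fun t ht => hmono hx (hx.trans_le ht) ht)
  simpa using (div_le_iff₀ (pow_pos hx _)).1 (nonpos_of_mul_nonpos_right hle (Real.exp_pos _))

lemma mul_add_nonpos (hu : ∀ x, HasDerivAt u (x * u x + r x + H x) x)
    (hr : ∀ x, HasDerivAt r (l * u x) x) (hH : ∀ x, 0 ≤ H x) (hr0 : ∀ x, r x ≤ 0)
    (hU : ∀ x, |u x| ≤ U) (hR : ∀ x, |r x| ≤ R) (x : ℝ) : x * u x + r x ≤ 0 := by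
  rcases lt_trichotomy x 0 with hx | rfl | hx
  · have reflected := mul_add_nonpos_of_pos (l := l) (u := fun x => -u (-x))
      (r := fun x => r (-x)) (H := fun x => H (-x))
      (fun x => by
        convert! ((hu (-x)).comp x (hasDerivAt_neg x)).neg using 1
        ring)
      (fun x => by
        convert! (hr (-x)).comp x (hasDerivAt_neg x) using 1
        ring)
      (fun x => hH _) (fun x => hr0 _) (fun x => by simpa using hU (-x)) (fun x => hR _)
      (neg_pos.2 hx)
    simpa using reflected
  · simpa using hr0 0
  · exact mul_add_nonpos_of_pos hu hr hH hr0 hU hR hx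

lemma abs_mul_add_le {M : ℝ} (hu : ∀ x, HasDerivAt u (x * u x + r x + H x) x)
    (hr : ∀ x, HasDerivAt r (l * u x) x) (hH : ∀ x, |H x| ≤ M) (hR : ∀ x, |r x| ≤ M)
    (hU : ∀ x, |u x| ≤ U) (x : ℝ) : |x * u x + r x| ≤ M := by
  have hM : 0 ≤ M := (abs_nonneg _).trans (hH 0)
  have upper := mul_add_nonpos (l := l) (u := u) (r := fun x => r x - M) (H := fun x => H x + M)
    (fun x => by convert! hu x using 1; ring) (fun x => (hr x).sub_const M)
    (fun x => by linarith [neg_le_of_abs_le (hH x)])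
    (fun x => by linarith [le_of_abs_le (hR x)]) hU
    (fun x => (abs_sub _ _).trans (add_le_add (hR x) (abs_of_nonneg hM).le)) x
  have lower := mul_add_nonpos (l := l) (u := fun x => -u x) (r := fun x => -r x - M)
    (H := fun x => M - H x)
    (fun x => by convert! (hu x).neg using 1; ring)
    (fun x => by convert! (hr x).neg.sub_const M using 1; ring)
    (fun x => by linarith [le_of_abs_le (hH x)])
    (fun x => by linarith [neg_le_of_abs_le (hR x)]) (fun x => by simpa using hU x)
    (fun x => (abs_sub _ _).trans
      (add_le_add ((abs_neg _).trans_le (hR x)) (abs_of_nonneg hM).le)) x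
  rw [abs_le]
  constructor <;> linarith

end Comparison

/-! ### The Stein equation -/

/-- The bounded solution `f` of the Stein equation `f' - x f = h - Φ h`. -/
noncomputable def steinSolution (h : ℝ → ℝ) (x : ℝ) : ℝ := -ouResolvent 0 (deriv h) x

/-- The term `r_j` in the equation `f^{(j+1)} = x f^{(j)} + r_j + h^{(j)}` which the solution `f`
of the Stein equation satisfies after `j` differentiations. -/
noncomputable def steinLowerTerm (h : ℝ → ℝ) : ℕ → ℝ → ℝ
  | 0, _ => -normalExp h
  | j + 1, x => ((j : ℝ) + 1) * iteratedDeriv j (steinSolution h) x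

section SteinEquation

variable {p j : ℕ} {h : ℝ → ℝ}

lemma iteratedDeriv_steinSolution (hh : MemCb (p + 1) h) (hj : j ≤ p) :
    iteratedDeriv j (steinSolution h) = fun x => -ouResolvent j (iteratedDeriv (j + 1) h) x := by
  induction j with
  | zero => simp [iteratedDeriv_one, steinSolution, funext_iff]
  | succ j ih =>
    have regular : MemCb 1 (iteratedDeriv (j + 1) h) := (hh.mono (by lia)).iteratedDeriv
    rw [iteratedDeriv_succ, ih (by lia), iteratedDeriv_succ (n := j + 1)]
    exact funext fun x => (hasDerivAt_ouResolvent regular j x).neg.deriv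

lemma abs_iteratedDeriv_steinSolution_le (hh : MemCb (p + 1) h) (hj : j ≤ p) (x : ℝ) :
    |iteratedDeriv j (steinSolution h) x| ≤ supNorm (iteratedDeriv (j + 1) h) / ((j : ℝ) + 1) := by
  rw [iteratedDeriv_steinSolution hh hj, abs_neg]
  exact abs_ouResolvent_le (hh.abs_iteratedDeriv_le (by lia)) j x

lemma memCb_steinSolution (hh : MemCb (p + 1) h) : MemCb p (steinSolution h) := by
  refine ⟨fun j hj x => ?_, fun j hj => ⟨_, abs_iteratedDeriv_steinSolution_le hh hj⟩⟩
  have regular : MemCb 1 (iteratedDeriv (j + 1) h) := (hh.mono (by lia)).iteratedDeriv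
  rw [iteratedDeriv_steinSolution hh hj.le]
  exact (hasDerivAt_ouResolvent regular j x).neg.differentiableAt

lemma hasDerivAt_steinLowerTerm (hh : MemCb (p + 1) h) (hj : j ≤ p) (x : ℝ) :
    HasDerivAt (steinLowerTerm h j) (j * iteratedDeriv j (steinSolution h) x) x := by
  cases j with
  | zero =>
    rw [Nat.cast_zero, zero_mul]
    exact hasDerivAt_const x (-normalExp h)
  | succ j =>
    rw [Nat.cast_succ]
    exact ((memCb_steinSolution hh).hasDerivAt_iteratedDeriv hj x).const_mul ((j : ℝ) + 1)

lemma abs_normalExp_le (hh : MemCb p h) : |normalExp h| ≤ supNorm h := by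
  simpa [normalExp] using norm_integral_le_of_norm_le_const (μ := gaussianReal 0 1) (f := h)
    (.of_forall hh.abs_le)

lemma abs_steinLowerTerm_le (hh : MemCb (p + 1) h) (hj : j ≤ p) (x : ℝ) :
    |steinLowerTerm h j x| ≤ supNorm (iteratedDeriv j h) := by
  cases j with
  | zero => simpa [steinLowerTerm] using abs_normalExp_le hh
  | succ j =>
    have hpos : (0 : ℝ) < (j : ℝ) + 1 := by positivity
    rw [steinLowerTerm, abs_mul, abs_of_pos hpos, mul_comm, ← le_div_iff₀ hpos]
    exact abs_iteratedDeriv_steinSolution_le hh (by lia) x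

lemma deriv_steinSolution (hh : MemCb 2 h) (x : ℝ) :
    deriv (steinSolution h) x = x * steinSolution h x - normalExp h + h x := by
  have stein := ouResolvent_stein_equation hh x
  rw [← iteratedDeriv_one, iteratedDeriv_steinSolution hh le_rfl, iteratedDeriv_succ,
    iteratedDeriv_one, steinSolution]
  linarith

lemma iteratedDeriv_succ_steinSolution (hh : MemCb (p + 1) h) (hj : j < p) (x : ℝ) :
    iteratedDeriv (j + 1) (steinSolution h) x =
      x * iteratedDeriv j (steinSolution h) x + steinLowerTerm h j x + iteratedDeriv j h x := by
  induction j generalizing x with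
  | zero =>
    simpa [iteratedDeriv_one, steinLowerTerm, sub_eq_add_neg] using
      deriv_steinSolution (hh.mono (by lia)) x
  | succ j ih =>
    have hf := (memCb_steinSolution hh).hasDerivAt_iteratedDeriv (k := j) (by lia) x
    have hderiv := ((((hasDerivAt_id' x).fun_mul hf).fun_add
      (hasDerivAt_steinLowerTerm hh (by lia : j ≤ p) x)).fun_add
      (hh.hasDerivAt_iteratedDeriv (k := j) (by lia) x)).deriv
    rw [← funext (ih (by lia)), ← iteratedDeriv_succ] at hderiv
    rw [hderiv, steinLowerTerm]
    ring

lemma abs_iteratedDeriv_succ_steinSolution_le (hh : MemCb (p + 1) h) (hj : j < p) (x : ℝ) :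
    |iteratedDeriv (j + 1) (steinSolution h) x| ≤ 2 * supNorm (iteratedDeriv j h) := by
  have hH := hh.abs_iteratedDeriv_le (show j ≤ p + 1 by lia)
  have comparison := abs_mul_add_le (l := j) (u := iteratedDeriv j (steinSolution h))
    (r := steinLowerTerm h j) (H := iteratedDeriv j h)
    (fun x => iteratedDeriv_succ_steinSolution hh hj x ▸
      (memCb_steinSolution hh).hasDerivAt_iteratedDeriv hj x)
    (hasDerivAt_steinLowerTerm hh hj.le) hH (abs_steinLowerTerm_le hh hj.le)
    (abs_iteratedDeriv_steinSolution_le hh hj.le) x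
  rw [iteratedDeriv_succ_steinSolution hh hj, two_mul]
  exact (abs_add_le _ _).trans (add_le_add comparison (hH x))

lemma abs_iteratedDeriv_steinSolution_le_gamma (hh : MemCb (p + 1) h) (x : ℝ) :
    |iteratedDeriv p (steinSolution h) x| ≤ Real.Gamma (((p : ℝ) + 1) / 2) *
      supNorm (iteratedDeriv p h) / (Real.sqrt 2 * Real.Gamma ((p : ℝ) / 2 + 1)) := by
  have regular : MemCb 1 (iteratedDeriv p h) := (hh.mono (by lia)).iteratedDeriv
  rw [iteratedDeriv_steinSolution hh le_rfl, abs_neg, iteratedDeriv_succ]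
  exact abs_ouResolvent_deriv_le regular p x

lemma supNorm_iteratedDeriv_steinSolution_le (hp : 1 ≤ p) (hh : MemCb (p + 1) h) :
    supNorm (iteratedDeriv p (steinSolution h)) ≤ N h p := by
  obtain ⟨m, rfl⟩ := Nat.exists_eq_add_of_le' hp
  refine supNorm_le fun x => le_min ?_ (le_min (abs_iteratedDeriv_steinSolution_le_gamma hh x)
    (abs_iteratedDeriv_steinSolution_le hh le_rfl x))
  refine (abs_iteratedDeriv_succ_steinSolution_le hh m.lt_succ_self x).trans ?_
  rw [Nat.add_sub_cancel]
  linarith [supNorm_nonneg (iteratedDeriv m h)]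

end SteinEquation

/-! ### Sums of independent random variables -/

section Independence

variable {Ω : Type*} [MeasurableSpace Ω] {P : Measure Ω} {V Y : Ω → ℝ} {f : ℝ → ℝ} {m n k : ℕ}

lemma integrable_pow_of_le [IsFiniteMeasure P] (hY : AEMeasurable Y P)
    (hYn : Integrable (fun ω => |Y ω| ^ n) P) (hk : k ≤ n) : Integrable (fun ω => Y ω ^ k) P :=
  (integrable_norm_pow_of_le hY.aestronglyMeasurable hk hYn).mono'
    (hY.pow_const k).aestronglyMeasurable (.of_forall fun ω => (norm_pow (Y ω) k).le)

lemma integrable_iteratedDeriv_comp_mul (hf : MemCb n f) (hfm : Measurable f) (hk : k ≤ n)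
    (hV : AEMeasurable V P) (hY : Integrable Y P) :
    Integrable (fun ω => iteratedDeriv k f (V ω) * Y ω) P :=
  hY.bdd_mul ((measurable_iteratedDeriv hfm k).comp_aemeasurable hV).aestronglyMeasurable
    (.of_forall fun ω => hf.abs_iteratedDeriv_le hk (V ω))

lemma integral_comp_mul_pow (hVY : IndepFun V Y P) (hV : AEMeasurable V P)
    (hY : AEMeasurable Y P) (hfm : Measurable f) (k : ℕ) :
    ∫ ω, f (V ω) * Y ω ^ k ∂P = (∫ ω, f (V ω) ∂P) * ∫ ω, Y ω ^ k ∂P :=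
  (hVY.comp hfm (measurable_id.pow_const k)).integral_fun_mul_eq_mul_integral
    (hfm.comp_aemeasurable hV).aestronglyMeasurable (hY.pow_const k).aestronglyMeasurable

lemma MemCb.abs_pow_mul_taylor_remainder_le (hf : MemCb n f) (k : ℕ) (a b : ℝ) :
    |b ^ k * f (a + b) - ∑ j ∈ Finset.range n, iteratedDeriv j f a * b ^ (k + j) / (j ! : ℝ)| ≤
      supNorm (iteratedDeriv n f) * |b| ^ (k + n) / (n ! : ℝ) := by
  have factor : b ^ k * f (a + b) -
      ∑ j ∈ Finset.range n, iteratedDeriv j f a * b ^ (k + j) / (j ! : ℝ) =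
      b ^ k * (f (a + b) - ∑ j ∈ Finset.range n, iteratedDeriv j f a * b ^ j / (j ! : ℝ)) := by
    rw [mul_sub, Finset.mul_sum]
    congr! 2
    ring
  rw [factor, abs_mul, abs_pow]
  refine (mul_le_mul_of_nonneg_left (hf.abs_taylor_remainder_le a b) (by positivity)).trans_eq ?_
  ring

lemma abs_integral_pow_mul_comp_add_sub_le [IsFiniteMeasure P] (hf : MemCb n f)
    (hfm : Measurable f) (hV : AEMeasurable V P) (hY : AEMeasurable Y P) (hVY : IndepFun V Y P)
    (hYn : Integrable (fun ω => |Y ω| ^ (k + n)) P) :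
    |(∫ ω, Y ω ^ k * f (V ω + Y ω) ∂P) - ∑ j ∈ Finset.range n,
        (∫ ω, iteratedDeriv j f (V ω) ∂P) * (∫ ω, Y ω ^ (k + j) ∂P) / (j ! : ℝ)| ≤
      supNorm (iteratedDeriv n f) * (∫ ω, |Y ω| ^ (k + n) ∂P) / (n ! : ℝ) := by
  have integrable : Integrable (fun ω => Y ω ^ k * f (V ω + Y ω)) P :=
    (integrable_pow_of_le hY hYn (Nat.le_add_right k n)).mul_bdd
      (hfm.comp_aemeasurable (hV.add hY)).aestronglyMeasurable (.of_forall fun ω => hf.abs_le _)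
  have integrable_term (j : ℕ) (hj : j ∈ Finset.range n) :
      Integrable (fun ω => iteratedDeriv j f (V ω) * Y ω ^ (k + j) / (j ! : ℝ)) P := by
    have hjn := (Finset.mem_range.1 hj).le
    exact (integrable_iteratedDeriv_comp_mul hf hfm hjn hV
      (integrable_pow_of_le hY hYn (Nat.add_le_add_left hjn k))).div_const _
  have integral_term (j : ℕ) :
      (∫ ω, iteratedDeriv j f (V ω) ∂P) * (∫ ω, Y ω ^ (k + j) ∂P) / (j ! : ℝ) =
        ∫ ω, iteratedDeriv j f (V ω) * Y ω ^ (k + j) / (j ! : ℝ) ∂P := by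
    rw [integral_div, integral_comp_mul_pow hVY hV hY (measurable_iteratedDeriv hfm j)]
  simp only [integral_term]
  rw [← integral_finsetSum _ integrable_term,
    ← integral_sub integrable (integrable_finsetSum _ integrable_term), ← integral_const_mul,
    ← integral_div, ← Real.norm_eq_abs]
  refine norm_integral_le_of_norm_le ((hYn.const_mul _).div_const _) (.of_forall fun ω => ?_)
  exact hf.abs_pow_mul_taylor_remainder_le k (V ω) (Y ω)

lemma sum_mul_integral_pow_succ {v : NNReal}
    (hmom : ∀ k ≤ m + 1, ∫ ω, Y ω ^ k ∂P = ∫ x, x ^ k ∂gaussianReal 0 v) (a : ℕ → ℝ) :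
    ∑ j ∈ Finset.range (m + 1), a j * (∫ ω, Y ω ^ (1 + j) ∂P) / (j ! : ℝ) =
      v * ∑ j ∈ Finset.range m, a (j + 1) * (∫ ω, Y ω ^ j ∂P) / (j ! : ℝ) := by
  have mean : ∫ ω, Y ω ^ (1 + 0) ∂P = 0 := by
    rw [hmom _ (by lia)]
    simp
  rw [Finset.sum_range_succ', mean, mul_zero, zero_div, add_zero, Finset.mul_sum]
  refine Finset.sum_congr rfl fun j hj => ?_
  have hjm := Finset.mem_range.1 hj
  rw [add_comm 1 (j + 1), hmom (j + 2) (by lia), integral_pow_add_two_gaussianReal,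
    hmom j (by lia), Nat.factorial_succ]
  push_cast
  field_simp

lemma abs_stein_summand_le [IsFiniteMeasure P] {v : NNReal} (hf : MemCb (m + 1) f)
    (hV : AEMeasurable V P) (hY : AEMeasurable Y P) (hVY : IndepFun V Y P)
    (hYm : Integrable (fun ω => |Y ω| ^ (m + 2)) P)
    (hmom : ∀ k ≤ m + 1, ∫ ω, Y ω ^ k ∂P = ∫ x, x ^ k ∂gaussianReal 0 v) :
    |v * (∫ ω, deriv f (V ω + Y ω) ∂P) - ∫ ω, Y ω * f (V ω + Y ω) ∂P| ≤
      supNorm (iteratedDeriv (m + 1) f) * (v * ((∫ ω, |Y ω| ^ m ∂P) / (m ! : ℝ)) +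
        (∫ ω, |Y ω| ^ (m + 2) ∂P) / ((m + 1)! : ℝ)) := by
  have taylor_deriv := abs_integral_pow_mul_comp_add_sub_le (k := 0) hf.deriv (measurable_deriv f)
    hV hY hVY (by
      simpa using integrable_norm_pow_of_le hY.aestronglyMeasurable (by lia) hYm)
  have taylor := abs_integral_pow_mul_comp_add_sub_le (k := 1) hf hf.continuous.measurable
    hV hY hVY (by simpa only [add_comm, add_left_comm] using hYm)
  have cancel := sum_mul_integral_pow_succ hmom fun j => ∫ ω, iteratedDeriv j f (V ω) ∂P
  simp only [← iteratedDeriv_succ', zero_add, pow_zero, one_mul] at taylor_deriv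
  rw [cancel, show 1 + (m + 1) = m + 2 by ring] at taylor
  simp only [pow_one] at taylor
  calc _ ≤ _ := abs_sub_le _ (v * ∑ j ∈ Finset.range m,
          (∫ ω, iteratedDeriv (j + 1) f (V ω) ∂P) * (∫ ω, Y ω ^ j ∂P) / (j ! : ℝ)) _
    _ ≤ v * (supNorm (iteratedDeriv (m + 1) f) * (∫ ω, |Y ω| ^ m ∂P) / (m ! : ℝ)) +
          supNorm (iteratedDeriv (m + 1) f) * (∫ ω, |Y ω| ^ (m + 2) ∂P) / ((m + 1)! : ℝ) := by
        rw [← mul_sub, abs_mul, NNReal.abs_eq, abs_sub_comm _ (∫ ω, Y ω * f (V ω + Y ω) ∂P)]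
        gcongr
    _ = _ := by ring

end Independence

section NormalApproximation

variable {Ω : Type*} [MeasurableSpace Ω] {P : Measure Ω} {ι : Type*} [Fintype ι]
  {Y : ι → Ω → ℝ} {v : ι → NNReal} {p : ℕ} {h : ℝ → ℝ}

lemma integral_comp_sum_sub_normalExp [IsProbabilityMeasure P] (hh : MemCb 2 h)
    (hY : ∀ i, Integrable (Y i) P) (hv : ∑ i, v i = 1) :
    (∫ ω, h (∑ i, Y i ω) ∂P) - normalExp h =
      ∑ i, (v i * (∫ ω, deriv (steinSolution h) (∑ j, Y j ω) ∂P) -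
        ∫ ω, Y i ω * steinSolution h (∑ j, Y j ω) ∂P) := by
  have hf : MemCb 1 (steinSolution h) := memCb_steinSolution hh
  have hS : AEMeasurable (fun ω => ∑ i, Y i ω) P :=
    Finset.aemeasurable_fun_sum _ fun i _ => (hY i).aemeasurable
  have integrable_h : Integrable (fun ω => h (∑ i, Y i ω)) P :=
    integrable_of_abs_le (hh.continuous.measurable.comp_aemeasurable hS) fun ω => hh.abs_le _
  have integrable_deriv : Integrable (fun ω => deriv (steinSolution h) (∑ i, Y i ω)) P :=
    integrable_of_abs_le ((measurable_deriv _).comp_aemeasurable hS) fun ω => hf.deriv.abs_le _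
  have integrable_mul (i : ι) : Integrable (fun ω => Y i ω * steinSolution h (∑ j, Y j ω)) P :=
    (hY i).mul_bdd (hf.continuous.measurable.comp_aemeasurable hS).aestronglyMeasurable
      (.of_forall fun ω => hf.abs_le _)
  have stein (ω : Ω) : h (∑ i, Y i ω) - normalExp h = deriv (steinSolution h) (∑ i, Y i ω) -
      ∑ i, Y i ω * steinSolution h (∑ j, Y j ω) := by
    rw [deriv_steinSolution hh, ← Finset.sum_mul]
    ring
  have total_variance : ∑ i, (v i : ℝ) = 1 := mod_cast hv
  rw [Finset.sum_sub_distrib, ← Finset.sum_mul, total_variance, one_mul,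
    ← integral_finsetSum _ fun i _ => integrable_mul i,
    ← integral_sub integrable_deriv (integrable_finsetSum _ fun i _ => integrable_mul i)]
  simp only [← stein]
  rw [integral_sub integrable_h (integrable_const _), integral_const, probReal_univ, one_smul]

theorem abs_integral_comp_sum_sub_normalExp_le (hp : 1 ≤ p) (hh : MemCb (p + 1) h)
    (hY : ∀ i, AEMeasurable (Y i) P) (hind : iIndepFun Y P)
    (hYp : ∀ i, Integrable (fun ω => |Y i ω| ^ (p + 1)) P)
    (hmom : ∀ i, ∀ k ≤ p, ∫ ω, Y i ω ^ k ∂P = ∫ x, x ^ k ∂gaussianReal 0 (v i))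
    (hv : ∑ i, v i = 1) :
    |(∫ ω, h (∑ i, Y i ω) ∂P) - normalExp h| ≤
      N h p * ∑ i, (v i * ((∫ ω, |Y i ω| ^ (p - 1) ∂P) / ((p - 1)! : ℝ)) +
        (∫ ω, |Y i ω| ^ (p + 1) ∂P) / (p ! : ℝ)) := by
  classical
  have := hind.isProbabilityMeasure
  have integrable (i : ι) : Integrable (Y i) P := by
    simpa using integrable_pow_of_le (hY i) (hYp i) (show 1 ≤ p + 1 by lia)
  rw [integral_comp_sum_sub_normalExp (hh.mono (by lia)) integrable hv, Finset.mul_sum]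
  refine (Finset.abs_sum_le_sum_abs _ _).trans (Finset.sum_le_sum fun i _ => ?_)
  obtain ⟨m, rfl⟩ := Nat.exists_eq_add_of_le' hp
  have split (ω : Ω) : ∑ j, Y j ω = (∑ j ∈ Finset.univ.erase i, Y j) ω + Y i ω := by
    rw [Finset.sum_apply, Finset.sum_erase_add _ _ (Finset.mem_univ i)]
  simp only [split]
  refine (abs_stein_summand_le (memCb_steinSolution hh)
    (Finset.aemeasurable_sum _ fun j _ => hY j) (hY i)
    (hind.indepFun_finsetSum_of_notMem₀ hY (Finset.notMem_erase i _)) (hYp i) (hmom i)).trans ?_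
  exact mul_le_mul_of_nonneg_right (supNorm_iteratedDeriv_steinSolution_le hp hh) (by positivity)

end NormalApproximation

section StandardizedSums

variable {n p : ℕ} {h : ℝ → ℝ} {Ω : Type*} [MeasurableSpace Ω] {P : Measure Ω}
  {X : Fin n → Ω → ℝ}

lemma integral_pow_gaussianReal_inv (n k : ℕ) :
    ∫ x, x ^ k ∂gaussianReal 0 (n : NNReal)⁻¹ =
      (∫ x, x ^ k ∂gaussianReal 0 1) / Real.sqrt n ^ k := by
  have scale : (gaussianReal 0 1).map (· / Real.sqrt n) = gaussianReal 0 (n : NNReal)⁻¹ := by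
    rw [gaussianReal_map_div_const, zero_div, one_div]
    congr 1
    ext
    simp
  rw [← scale, integral_map (by fun_prop) (by fun_prop), ← integral_div]
  simp only [div_pow]

lemma sqrt_natCast_pow_succ (n p : ℕ) :
    Real.sqrt n ^ (p + 1) = (n : ℝ) ^ (((p : ℝ) + 1) / 2) := by
  rw [Real.sqrt_eq_rpow, ← Real.rpow_mul_natCast n.cast_nonneg]
  congr 1
  push_cast
  ring

lemma error_le_bound (hp : 1 ≤ p) (hh : MemCb (p + 1) h) (hn : 1 ≤ n)
    (hX : ∀ i, AEMeasurable (X i) P) (hind : iIndepFun X P)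
    (hXp : ∀ i, Integrable (fun ω => |X i ω| ^ (p + 1)) P)
    (hmom : ∀ i, ∀ k : ℕ, 1 ≤ k → k ≤ p →
      ∫ ω, X i ω ^ k ∂P = ∫ x, x ^ k ∂(gaussianReal 0 1)) :
    error P h X ≤ bound P h p X := by
  have := hind.isProbabilityMeasure
  have hn0 : (0 : ℝ) < n := mod_cast hn
  have abs_scaled (i : Fin n) (k : ℕ) (ω : Ω) :
      |X i ω / Real.sqrt n| ^ k = |X i ω| ^ k / Real.sqrt n ^ k := by
    rw [abs_div, abs_of_nonneg (Real.sqrt_nonneg _), div_pow]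
  have matching (i : Fin n) (k : ℕ) (hk : k ≤ p) : ∫ ω, (X i ω / Real.sqrt n) ^ k ∂P =
      ∫ x, x ^ k ∂gaussianReal 0 (n : NNReal)⁻¹ := by
    rcases k.eq_zero_or_pos with rfl | hk0
    · simp
    simp only [div_pow]
    rw [integral_div, hmom i k hk0 hk, integral_pow_gaussianReal_inv]
  have scaled := abs_integral_comp_sum_sub_normalExp_le (v := fun _ => (n : NNReal)⁻¹) hp hh
    (fun i => (hX i).div_const (Real.sqrt n))
    (hind.comp (fun _ x => x / Real.sqrt n) fun _ => measurable_id.div_const _)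
    (fun i => by simpa only [abs_scaled] using (hXp i).div_const _) matching
    (by simp [(Nat.one_le_iff_ne_zero.1 hn)])
  have sqrt_pow : Real.sqrt n ^ (p + 1) = Real.sqrt n ^ (p - 1) * n := by
    rw [show p + 1 = p - 1 + 2 by lia, pow_add, Real.sq_sqrt hn0.le]
  have rescale (a b : ℝ) : (n : ℝ)⁻¹ * (a / Real.sqrt n ^ (p - 1)) + b / Real.sqrt n ^ (p + 1) =
      (a + b) / Real.sqrt n ^ (p + 1) := by
    rw [sqrt_pow]
    field_simp
  simp only [error, W, bound, Finset.sum_div]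
  refine scaled.trans_eq ?_
  simp only [abs_scaled, integral_div, NNReal.coe_inv, NNReal.coe_natCast]
  simp only [div_right_comm _ (Real.sqrt n ^ _), rescale]
  rw [← Finset.sum_div, ← sqrt_natCast_pow_succ, div_mul_eq_mul_div, mul_div_assoc]

end StandardizedSums

/-! ### Identically distributed summands -/

section IdenticallyDistributed

variable {p : ℕ} {h : ℝ → ℝ} {μ : Measure ℝ}

lemma N_pos (hh : MemCb (p + 1) h) (hconst : ¬∃ a, ∀ x, h x = a) : 0 < N h p := by
  have norm_pos {k : ℕ} (hk : k ≤ p + 1) := hh.supNorm_iteratedDeriv_pos hk hconst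
  have h₁ := norm_pos (show p - 1 ≤ p + 1 by lia)
  have h₂ := norm_pos (show p ≤ p + 1 by lia)
  have h₃ := norm_pos le_rfl
  exact lt_min (by positivity) (lt_min (by positivity) (by positivity))

/-- The summand `E|X|^{p-1} / (p-1)! + E|X|^{p+1} / p!` of `bound` for a random variable `X` of
law `μ`. -/
noncomputable def absMomentSum (p : ℕ) (μ : Measure ℝ) : ℝ :=
  (∫ x, |x| ^ (p - 1) ∂μ) / ((p - 1)! : ℝ) + (∫ x, |x| ^ (p + 1) ∂μ) / (p ! : ℝ)

lemma absMomentSum_pos [IsProbabilityMeasure μ] (hp : 1 ≤ p) (hμ : MatchesNormal p μ) :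
    0 < absMomentSum p μ := by
  rcases hp.eq_or_lt with rfl | hp
  · exact add_pos_of_pos_of_nonneg (by simp) (by positivity)
  refine add_pos_of_nonneg_of_pos (by positivity) (div_pos ?_ (by positivity))
  refine (integral_nonneg fun x => by positivity).lt_of_ne' fun hzero => ?_
  rw [integral_eq_zero_iff_of_nonneg (fun x => by positivity) hμ.1] at hzero
  have second_moment : ∫ x, x ^ 2 ∂μ = 1 := by
    simpa [integral_pow_add_two_gaussianReal 1 0] using hμ.2 2 one_le_two hp
  have ae_zero : ∀ᵐ x ∂μ, x ^ 2 = 0 := hzero.mono fun x hx => by simpa using hx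
  exact one_ne_zero (second_moment.symm.trans (integral_eq_zero_of_ae ae_zero))

variable {n : ℕ} {Ω : Type*} [MeasurableSpace Ω] {P : Measure Ω} {X : Fin n → Ω → ℝ}

lemma bound_eq_of_map_eq (h : ℝ → ℝ) (p : ℕ) (hn : 1 ≤ n) (hX : ∀ i, AEMeasurable (X i) P)
    (hmap : ∀ i, P.map (X i) = μ) :
    bound P h p X = N h p * absMomentSum p μ * (n : ℝ) ^ (-(((p : ℝ) - 1) / 2)) := by
  have hn0 : (0 : ℝ) < n := mod_cast hn
  have moment (i : Fin n) (k : ℕ) : ∫ ω, |X i ω| ^ k ∂P = ∫ x, |x| ^ k ∂μ := by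
    rw [← hmap i, integral_map (hX i) (by fun_prop)]
  have power : (n : ℝ) ^ (-(((p : ℝ) - 1) / 2)) = n / (n : ℝ) ^ (((p : ℝ) + 1) / 2) := by
    nth_rw 2 [← Real.rpow_one (n : ℝ)]
    rw [← Real.rpow_sub hn0]
    congr 1
    ring
  simp only [bound, moment, Finset.sum_const, Finset.card_univ, Fintype.card_fin, nsmul_eq_mul]
  rw [power, absMomentSum]
  ring

lemma error_le_bound_of_map_eq (hp : 1 ≤ p) (hh : MemCb (p + 1) h) (hμ : MatchesNormal p μ)
    (hn : 1 ≤ n) (hX : ∀ i, AEMeasurable (X i) P) (hind : iIndepFun X P)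
    (hmap : ∀ i, P.map (X i) = μ) : error P h X ≤ bound P h p X := by
  refine error_le_bound hp hh hn hX hind (fun i => ?_) fun i k hk hkp => ?_
  · exact (hmap i ▸ hμ.1).comp_aemeasurable (hX i)
  · rw [← hμ.2 k hk hkp, ← hmap i, integral_map (hX i) (by fun_prop)]

end IdenticallyDistributed

end MatchingMoments

/-- First part: the bound for independent random variables with matching moments.
Second part: for independent variables with a common law `μ`, the bound (hence the error) is of
order `n^{-(p-1)/2}`, with constants that depend only on `p`, `h` and `μ`; the order is exact as
soon as `h` is not constant (for constant `h` the bound is zero). -/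
theorem mainTheorem4 (p : ℕ) (hp : 1 ≤ p) (h : ℝ → ℝ)
    (hh : MatchingMoments.MemCb (p + 1) h) :
    (∀ (Ω : Type u) [MeasurableSpace Ω] (P : Measure Ω) [IsProbabilityMeasure P]
        (n : ℕ) (_ : 1 ≤ n) (X : Fin n → Ω → ℝ),
        (∀ i, Measurable (X i)) → iIndepFun X P →
        (∀ i, Integrable (fun ω => |X i ω| ^ (p + 1)) P) →
        (∀ i, ∀ k : ℕ, 1 ≤ k → k ≤ p →
          ∫ ω, X i ω ^ k ∂P = ∫ x, x ^ k ∂(gaussianReal 0 1)) →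
        MatchingMoments.error P h X ≤ MatchingMoments.bound P h p X) ∧
    (∀ (μ : Measure ℝ) [IsProbabilityMeasure μ], MatchingMoments.MatchesNormal p μ →
      ∃ c C : ℝ, ((¬ ∃ a : ℝ, ∀ x, h x = a) → 0 < c) ∧
        ∀ (Ω : Type u) [MeasurableSpace Ω] (P : Measure Ω) [IsProbabilityMeasure P]
          (n : ℕ) (_ : 1 ≤ n) (X : Fin n → Ω → ℝ),
          (∀ i, Measurable (X i)) → iIndepFun X P → (∀ i, P.map (X i) = μ) →
          MatchingMoments.error P h X ≤ C * (n : ℝ) ^ (-(((p : ℝ) - 1) / 2)) ∧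
          c * (n : ℝ) ^ (-(((p : ℝ) - 1) / 2)) ≤ MatchingMoments.bound P h p X ∧
          MatchingMoments.bound P h p X ≤ C * (n : ℝ) ^ (-(((p : ℝ) - 1) / 2))) := by
  refine ⟨fun Ω _ P _ n hn X hX hind hXp hmom =>
    MatchingMoments.error_le_bound hp hh hn (fun i => (hX i).aemeasurable) hind hXp hmom,
    fun μ _ hμ => ?_⟩
  let c := MatchingMoments.N h p * MatchingMoments.absMomentSum p μ
  refine ⟨c, c, fun hconst =>
    mul_pos (MatchingMoments.N_pos hh hconst) (MatchingMoments.absMomentSum_pos hp hμ),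
    fun Ω _ P _ n hn X hX hind hmap => ?_⟩
  have hX' (i : Fin n) : AEMeasurable (X i) P := (hX i).aemeasurable
  have rate := MatchingMoments.bound_eq_of_map_eq h p hn hX' hmap
  have error_le := MatchingMoments.error_le_bound_of_map_eq hp hh hμ hn hX' hind hmap
  exact ⟨error_le.trans_eq rate, rate.ge, rate.le⟩
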